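/- A 3-uniform hypergraph is linear if any two distinct hyperedges share at most one vertex. A Berge 5-cycle in a hypergraph consists of distinct vertices $v_1,\dots,v_5$ and distinct hyperedges $h_1,\dots,h_5$ with $v_i,v_{i+1}\in h_i$ for $1\le i\le 4$ and $v_5,v_1\in h_5$. Let $\mathrm{ex}^{\mathrm{lin}}_3(n,C_5)$ denote the maximum number of hyperedges in a 3-uniform linear hypergraph on $n$ vertices that contains no Berge 5-cycle. Then, as $n\to\infty$, $$\mathrm{ex}^{\mathrm{lin}}_3(n,C_5)=\frac{1}{3\sqrt3}\,n^{3/2}+O(n).$$ -/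

import Mathlib

open scoped Hypergraph

namespace Hypergraph

/-- A hypergraph is `r`-uniform if every hyperedge has exactly `r` vertices. -/
def IsUniform {α : Type*} (H : Hypergraph α) (r : ℕ) : Prop :=
  ∀ e ∈ E(H), e.encard = r

/-- A hypergraph is linear if any two distinct hyperedges have at most one vertex in common. -/
def IsLinear {α : Type*} (H : Hypergraph α) : Prop :=
  ∀ e ∈ E(H), ∀ f ∈ E(H), e ≠ f → (e ∩ f).encard ≤ 1

/-- `H` contains a Berge cycle of length `k`: distinct vertices `v 0, …, v (k - 1)` and distinct
hyperedges `h 0, …, h (k - 1)` such that `h i` contains `v i` and `v (i + 1)`, indices being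
taken cyclically (`finRotate k i` is `i + 1` modulo `k`). Meant for `k ≥ 2`. -/
def HasBergeCycle {α : Type*} (H : Hypergraph α) (k : ℕ) : Prop :=
  ∃ (v : Fin k → α) (h : Fin k → Set α), Function.Injective v ∧ Function.Injective h ∧
    (∀ i, h i ∈ E(H)) ∧ (∀ i, v i ∈ h i) ∧ (∀ i, v (finRotate k i) ∈ h i)

end Hypergraph

/-- The possible numbers of hyperedges of a `3`-uniform linear hypergraph on `n` vertices
without a Berge cycle of length `k`. -/
def linearTuranSizes (n k : ℕ) : Set ℕ :=
  {m | ∃ H : Hypergraph (Fin n), V(H) = Set.univ ∧ H.IsUniform 3 ∧ H.IsLinear ∧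
    ¬ H.HasBergeCycle k ∧ E(H).ncard = m}

/-- The linear Turán number of the Berge cycle of length `k`: the maximum number of hyperedges
in a `3`-uniform linear hypergraph on `n` vertices without a Berge cycle of length `k`. -/
noncomputable def linearTuran (n k : ℕ) : ℕ := sSup (linearTuranSizes n k)

/-- The supremum defining the linear Turán number is a maximum. -/
theorem linearTuran_isGreatest (n k : ℕ) (hk : 0 < k) :
    IsGreatest (linearTuranSizes n k) (linearTuran n k) := by
  have hb : BddAbove (linearTuranSizes n k) := by
    refine ⟨Nat.card (Set (Fin n)), ?_⟩
    rintro m ⟨H, -, -, -, -, rfl⟩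
    exact Set.ncard_le_card _
  have hne : (linearTuranSizes n k).Nonempty := by
    refine ⟨0, ⟨Set.univ, ∅, by simp⟩, rfl, ?_, ?_, ?_, by simp⟩
    · intro e he
      exact absurd he (Set.notMem_empty e)
    · intro e he
      exact absurd he (Set.notMem_empty e)
    · rintro ⟨v, h, -, -, hE, -⟩
      exact absurd (hE ⟨0, hk⟩) (Set.notMem_empty _)
  exact ⟨Nat.sSup_mem hne hb, fun m hm => le_csSup hb hm⟩

/-! Write `n = 3t²`, so that the main term is `t³`. Lower bound: take the axis-parallel lines of a
`d × d × d` cube as vertices and its points as triples. This gives `3d²` vertices and `d³` triples;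
`exists_unique_colour` rules out pentagons, and `d = ⌊t⌋` loses only `O(n)`.

Upper bound: fix a triple `e` and count the triples that leave the neighbourhoods of its three
vertices. A discharging argument gives at most `2n` of them plus a degree term
(`sum_card_outerTriples_le`). Summing over `e` bounds the degree products over ordered adjacent
pairs by `2n|E| + 25 ∑ d(v)²` (`sum_deg_mul_sum_deg_le`). From below, `d(v)d(w) + t³/d(v) + t³/d(w)
≥ 3t²`, where the reciprocals sum to at most `4nt³` because `v` occurs in `2d(v)` ordered pairs on
each side. Comparing gives `18t²|E| ≤ 6t²|E| + 12t⁵` up to lower-order terms, hence `|E| ≤ t³ +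
O(t²)`. Shifting degrees by 7 absorbs the `∑ d(v)²` error. -/

namespace TripleSystem

/-! ### Pentagon-free triple systems and triples with several neighbours of a vertex -/

section
open Finset

variable {V : Type*}

/-- A linear system of triples without a Berge cycle of length five. -/
structure PentagonFree (E : Finset (Finset V)) : Prop where
  card_eq : ∀ e ∈ E, #e = 3
  eq_of_mem : ∀ {e f x y}, e ∈ E → f ∈ E → x ≠ y → x ∈ e → y ∈ e → x ∈ f → y ∈ f → e = f
  no_pentagon : ∀ {v₁ v₂ v₃ v₄ v₅ : V} {h₁ h₂ h₃ h₄ h₅ : Finset V},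
    [v₁, v₂, v₃, v₄, v₅].Nodup → [h₁, h₂, h₃, h₄, h₅].Nodup →
    h₁ ∈ E → h₂ ∈ E → h₃ ∈ E → h₄ ∈ E → h₅ ∈ E →
    v₁ ∈ h₁ → v₂ ∈ h₁ → v₂ ∈ h₂ → v₃ ∈ h₂ → v₃ ∈ h₃ → v₄ ∈ h₃ → v₄ ∈ h₄ → v₅ ∈ h₄ →
    v₅ ∈ h₅ → v₁ ∈ h₅ → False

theorem PentagonFree.mono {E F : Finset (Finset V)} (hE : PentagonFree E) (hF : F ⊆ E) :
    PentagonFree F where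
  card_eq e he := hE.card_eq e (hF he)
  eq_of_mem he hf := hE.eq_of_mem (hF he) (hF hf)
  no_pentagon hv hh h1 h2 h3 h4 h5 :=
    hE.no_pentagon hv hh (hF h1) (hF h2) (hF h3) (hF h4) (hF h5)

variable [DecidableEq V]

/-- The number of triples containing `v`. -/
def deg (E : Finset (Finset V)) (v : V) : ℕ := #{e ∈ E | v ∈ e}

/-- The set of vertices sharing a triple with `v`. -/
def nbrs (E : Finset (Finset V)) (v : V) : Finset V :=
  ({e ∈ E | v ∈ e}.biUnion id).erase v

variable {E : Finset (Finset V)} {u v w x y z : V} {e f g h : Finset V}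

theorem mem_nbrs : w ∈ nbrs E v ↔ w ≠ v ∧ ∃ e ∈ E, v ∈ e ∧ w ∈ e := by
  simp [nbrs, and_assoc]

theorem mem_nbrs_comm : w ∈ nbrs E v ↔ v ∈ nbrs E w := by
  simp only [mem_nbrs, ne_comm]
  tauto

theorem PentagonFree.card_nbrs (hE : PentagonFree E) (v : V) : #(nbrs E v) = 2 * deg E v := by
  have h1 : nbrs E v = {e ∈ E | v ∈ e}.biUnion (fun e => e.erase v) := by
    ext w
    simp only [nbrs, mem_erase, mem_biUnion, mem_filter, id]
    tauto
  rw [h1, card_biUnion, sum_const_nat (m := 2), deg, mul_comm]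
  · intro e he
    rw [mem_filter] at he
    rw [card_erase_of_mem he.2, hE.card_eq e he.1]
  · intro e he f hf hef
    rw [mem_coe, mem_filter] at he hf
    simp only [Function.onFun]
    rw [disjoint_left]
    intro x hx hx'
    rw [mem_erase] at hx hx'
    exact hef (hE.eq_of_mem he.1 hf.1 hx.1 hx.2 he.2 hx'.2 hf.2)

/-- The triples avoiding `v` that contain at least two neighbours of `v`. -/
def innerTriples (E : Finset (Finset V)) (v : V) : Finset (Finset V) :=
  {h ∈ E | v ∉ h ∧ 2 ≤ #(h ∩ nbrs E v)}

/-- If two neighbours `w₂, w₃` of `v` in `h` both lay in many inner triples, one could leave `h` at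
both ends, to `w₁` and `w₄`, and close the pentagon `v w₁ w₂ w₃ w₄`. -/
theorem PentagonFree.exists_deg_innerTriples_le (hE : PentagonFree E)
    (hh : h ∈ innerTriples E v) :
    ∃ w ∈ h ∩ nbrs E v, #{g ∈ innerTriples E v | w ∈ g} ≤ 3 := by
  have hB : ∀ g ∈ innerTriples E v, g ∈ E ∧ v ∉ g ∧
      ∀ x, ∃ y ∈ g, y ∈ nbrs E v ∧ y ≠ x := by
    intro g hg
    rw [innerTriples, mem_filter] at hg
    refine ⟨hg.1, hg.2.1, fun x => ?_⟩
    obtain ⟨y, hy, hyx⟩ := exists_mem_ne (s := g ∩ nbrs E v) (by omega) x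
    exact ⟨y, (mem_inter.1 hy).1, (mem_inter.1 hy).2, hyx⟩
  obtain ⟨hhE, hvh, -⟩ := hB h hh
  have hc := hh
  rw [innerTriples, mem_filter] at hc
  obtain ⟨w₂, hw₂, w₃, hw₃, hne⟩ := one_lt_card.1 (show 1 < #(h ∩ nbrs E v) by omega)
  by_contra! hcon
  have h2 := hcon w₂ hw₂
  have h3 := hcon w₃ hw₃
  rw [mem_inter] at hw₂ hw₃
  obtain ⟨h₁, hh₁, hh₁h⟩ := exists_mem_ne (s := {g ∈ innerTriples E v | w₂ ∈ g}) (by omega) h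
  rw [mem_filter] at hh₁
  obtain ⟨hh₁E, hvh₁, hy⟩ := hB h₁ hh₁.1
  obtain ⟨w₁, hw₁, hw₁N, hw₁₂⟩ := hy w₂
  obtain ⟨hw₁v, f, hfE, hvf, hw₁f⟩ := mem_nbrs.1 hw₁N
  -- With `w₁` fixed, `w₄` must lie in the triple `f` through `v` and `w₁`. By linearity `w₄` and
  -- `w₃` determine `g`, so besides `h` at most two inner triples pass through `w₃`.
  have key : #({g ∈ innerTriples E v | w₃ ∈ g}.erase h) ≤ #(f.erase v) := by
    refine card_le_card_of_forall_subsingleton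
      (fun g y => y ∈ g ∧ y ≠ w₃) ?_ ?_
    · intro g hg
      rw [mem_erase, mem_filter] at hg
      obtain ⟨hgE, hvg, hy⟩ := hB g hg.2.1
      obtain ⟨w₄, hw₄, hw₄N, hw₄₃⟩ := hy w₃
      obtain ⟨hw₄v, f', hf'E, hvf', hw₄f'⟩ := mem_nbrs.1 hw₄N
      refine ⟨w₄, mem_erase.2 ⟨hw₄v, ?_⟩, hw₄, hw₄₃⟩
      by_contra hw₄f
      have hw₁₃ : w₁ ≠ w₃ := by
        rintro rfl
        exact hh₁h (hE.eq_of_mem hh₁E hhE hne hh₁.2 hw₁ hw₂.1 hw₃.1)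
      have hw₂₄ : w₂ ≠ w₄ := by
        rintro rfl
        exact hg.1 (hE.eq_of_mem hgE hhE hne hw₄ hg.2.2 hw₂.1 hw₃.1)
      have h13 : h₁ ≠ g := by
        rintro rfl
        exact hh₁h (hE.eq_of_mem hh₁E hhE hne hh₁.2 hg.2.2 hw₂.1 hw₃.1)
      have hw₂v : w₂ ≠ v := fun h => hvh (h ▸ hw₂.1)
      have hw₃v : w₃ ≠ v := fun h => hvh (h ▸ hw₃.1)
      refine hE.no_pentagon (v₁ := v) (v₂ := w₁) (v₃ := w₂) (v₄ := w₃) (v₅ := w₄) ?_ ?_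
        hfE hh₁E hhE hgE hf'E hvf hw₁f hw₁ hh₁.2 hw₂.1 hw₃.1 hg.2.2 hw₄ hw₄f' hvf'
      · grind
      · grind
    · intro y hy g hg g' hg'
      obtain ⟨hg, hyg, hy3⟩ := hg
      obtain ⟨hg', hyg', -⟩ := hg'
      rw [mem_erase, mem_filter] at hg hg'
      exact hE.eq_of_mem (hB g hg.2.1).1 (hB g' hg'.2.1).1 hy3 hyg hg.2.2 hyg' hg'.2.2
  rw [card_erase_of_mem hvf, hE.card_eq f hfE, card_erase_of_mem (by simp [hh, hw₃.1])] at key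
  omega

theorem PentagonFree.card_innerTriples_le (hE : PentagonFree E) (v : V) :
    #(innerTriples E v) ≤ 6 * deg E v := by
  have h1 : innerTriples E v ⊆ {w ∈ nbrs E v | #{g ∈ innerTriples E v | w ∈ g} ≤ 3}.biUnion
      (fun w => {g ∈ innerTriples E v | w ∈ g}) := by
    intro h hh
    obtain ⟨w, hw, hw3⟩ := hE.exists_deg_innerTriples_le hh
    rw [mem_inter] at hw
    simp only [mem_biUnion, mem_filter]
    exact ⟨w, ⟨hw.2, hw3⟩, hh, hw.1⟩
  have h2 := (card_le_card h1).trans (card_biUnion_le_card_mul _ _ 3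
    fun w hw => (mem_filter.1 hw).2)
  have h3 := card_filter_le (nbrs E v) (fun w => #{g ∈ innerTriples E v | w ∈ g} ≤ 3)
  rw [hE.card_nbrs] at h3
  omega

end

/-! ### Outer triples and discharging at a single vertex -/

section
open Finset

variable {V : Type*} [DecidableEq V]
variable {E : Finset (Finset V)} {u v w x y z : V} {e f g h : Finset V}

/-- The triples disjoint from `e` that contain exactly one neighbour of `v`. -/
def outerTriples (E : Finset (Finset V)) (e : Finset V) (v : V) : Finset (Finset V) :=
  {h ∈ E | Disjoint h e ∧ #(h ∩ nbrs E v) = 1}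

/-- The vertices outside `nbrs E v` in at least two triples of `outerTriples E e v`. -/
def heavy [Fintype V] (E : Finset (Finset V)) (e : Finset V) (v : V) : Finset V :=
  {x | x ∉ nbrs E v ∧ 2 ≤ #{h ∈ outerTriples E e v | x ∈ h}}

/-- The part of the triple `h` at distance two from `v`. -/
def far (E : Finset (Finset V)) (v : V) (h : Finset V) : Finset V := h \ nbrs E v

/-- Twice the total weight that `x` receives from the triples of `outerTriples E e v`, when each
triple `h` splits a unit weight between the two vertices of `far E v h`: equally, unless exactly one
of them is heavy, in which case the other one gets everything. -/
def charge [Fintype V] (E : Finset (Finset V)) (e : Finset V) (v x : V) : ℤ :=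
  ∑ h ∈ outerTriples E e v with x ∈ far E v h,
    (1 + #(far E v h ∩ heavy E e v) - 2 * if x ∈ heavy E e v then 1 else 0)

theorem mem_far : x ∈ far E v h ↔ x ∈ h ∧ x ∉ nbrs E v := by simp [far]

theorem mem_outerTriples : h ∈ outerTriples E e v ↔
    h ∈ E ∧ Disjoint h e ∧ #(h ∩ nbrs E v) = 1 := by simp [outerTriples]

theorem exists_of_mem_outerTriples (hh : h ∈ outerTriples E e v) :
    ∃ w ∈ h, w ∈ nbrs E v ∧ ∀ x ∈ h, x ∈ nbrs E v → x = w := by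
  obtain ⟨w, hw⟩ := card_eq_one.1 (mem_outerTriples.1 hh).2.2
  simp only [Finset.ext_iff, mem_inter, mem_singleton] at hw
  exact ⟨w, ((hw w).2 rfl).1, ((hw w).2 rfl).2, fun x hx hx' => (hw x).1 ⟨hx, hx'⟩⟩

theorem PentagonFree.card_far (hE : PentagonFree E) (hh : h ∈ outerTriples E e v) :
    #(far E v h) = 2 := by
  rw [mem_outerTriples] at hh
  have h1 := card_sdiff_add_card_inter h (nbrs E v)
  rw [hE.card_eq h hh.1, hh.2.2] at h1
  rw [far]
  omega

/-- A triple with `k` heavy far vertices hands out `2(1 + k) - 2k = 2` in total. -/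
theorem PentagonFree.sum_charge [Fintype V] (hE : PentagonFree E) (e : Finset V) (v : V) :
    ∑ x, charge E e v x = 2 * #(outerTriples E e v) := by
  simp only [charge, sum_filter]
  rw [sum_comm, mul_comm, ← nsmul_eq_mul, ← sum_const]
  refine sum_congr rfl fun h hh => ?_
  rw [← sum_filter, filter_mem_eq_inter, univ_inter, sum_sub_distrib, sum_const, ← mul_sum, hE.card_far hh,
    sum_boole, filter_mem_eq_inter]
  simp only [nsmul_eq_mul]
  push_cast
  ring

/-- If `x, y` are the far vertices of `h`, and `h₁, h₂` are further triples at `x` and at `y`, then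
the neighbours of `v` in `h₁` and `h₂` lie in a common triple with `v`. -/
theorem PentagonFree.mem_of_path (hE : PentagonFree E) (hve : v ∈ e) {h₁ h₂ : Finset V}
    {w₁ w₂ : V}
    (hh₁ : h₁ ∈ outerTriples E e v) (hh : h ∈ outerTriples E e v) (hh₂ : h₂ ∈ outerTriples E e v)
    (hx₁ : x ∈ h₁) (hx : x ∈ h) (hy : y ∈ h) (hy₂ : y ∈ h₂) (hxy : x ≠ y) (hxN : x ∉ nbrs E v)
    (hyN : y ∉ nbrs E v) (h₁h : h₁ ≠ h) (h₂h : h₂ ≠ h)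
    (hw₁ : w₁ ∈ h₁) (hw₁N : w₁ ∈ nbrs E v) (hw₂ : w₂ ∈ h₂) (hw₂N : w₂ ∈ nbrs E v)
    (hf : f ∈ E) (hvf : v ∈ f) (hw₁f : w₁ ∈ f) : w₂ ∈ f := by
  by_contra hw₂f
  obtain ⟨hw₂v, f', hf', hvf', hw₂f'⟩ := mem_nbrs.1 hw₂N
  obtain ⟨hw₁v, -⟩ := mem_nbrs.1 hw₁N
  have hv : ∀ g ∈ outerTriples E e v, g ∈ E ∧ v ∉ g := fun g hg =>
    ⟨(mem_outerTriples.1 hg).1, disjoint_right.1 (mem_outerTriples.1 hg).2.1 hve⟩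
  obtain ⟨hhE, hvh⟩ := hv h hh
  obtain ⟨hhE₁, hvh₁⟩ := hv h₁ hh₁
  obtain ⟨hhE₂, hvh₂⟩ := hv h₂ hh₂
  have h₁₂ : h₁ ≠ h₂ := by
    rintro rfl
    exact h₁h (hE.eq_of_mem hhE₁ hhE hxy hx₁ hy₂ hx hy)
  refine hE.no_pentagon (v₁ := v) (v₂ := w₁) (v₃ := x) (v₄ := y) (v₅ := w₂) ?_ ?_
    hf hhE₁ hhE hhE₂ hf' hvf hw₁f hw₁ hx₁ hx hy hy₂ hw₂ hw₂f' hvf'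
  · simp only [List.nodup_cons, List.mem_cons, List.not_mem_nil, or_false, not_or]
    grind
  · simp only [List.nodup_cons, List.mem_cons, List.not_mem_nil, or_false, not_or]
    grind

/-- With three such triples, each other far vertex `yᵢ` has a second outer triple `gᵢ`. Chaining
`mem_of_path` through `g₁` and `g₃` puts the three distinct neighbours `w₁, w₂, w₃` in one triple
with `v`, which is one vertex too many. -/
theorem PentagonFree.card_heavyTriples_le [Fintype V] (hE : PentagonFree E) (hve : v ∈ e)
    (hxN : x ∉ nbrs E v) :
    #{h ∈ outerTriples E e v | x ∈ h ∧ far E v h ⊆ heavy E e v} ≤ 2 := by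
  by_contra! hcon
  obtain ⟨h₁, hh₁, h₂, hh₂, h₃, hh₃, h12, h13, h23⟩ := two_lt_card.1 hcon
  have aux : ∀ h ∈ {h ∈ outerTriples E e v | x ∈ h ∧ far E v h ⊆ heavy E e v},
      h ∈ E ∧ h ∈ outerTriples E e v ∧ x ∈ h ∧ (∃ w ∈ h, w ∈ nbrs E v) ∧
      ∃ y ∈ h, y ≠ x ∧ y ∉ nbrs E v ∧ ∃ g ∈ outerTriples E e v, g ≠ h ∧ y ∈ g ∧
      ∃ w ∈ g, w ∈ nbrs E v := by
    intro h hh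
    rw [mem_filter] at hh
    obtain ⟨w, hw, hwN, -⟩ := exists_of_mem_outerTriples hh.1
    obtain ⟨y, hy, hyx⟩ := exists_mem_ne (by rw [hE.card_far hh.1]; norm_num) x
    have hyL := hh.2.2 hy
    rw [heavy, mem_filter] at hyL
    obtain ⟨g, hg, hgh⟩ := exists_mem_ne hyL.2.2 h
    rw [mem_filter] at hg
    obtain ⟨w', hw', hwN', -⟩ := exists_of_mem_outerTriples hg.1
    exact ⟨(mem_outerTriples.1 hh.1).1, hh.1, hh.2.1, ⟨w, hw, hwN⟩, y, (mem_far.1 hy).1, hyx,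
      hyL.2.1, g, hg.1, hgh, hg.2, w', hw', hwN'⟩
  obtain ⟨hE₁, hQ₁, hx₁, ⟨w₁, hw₁, hwN₁⟩, y₁, hy₁, hyx₁, hyN₁, g₁, hg₁, hgh₁, hyg₁, u₁, hu₁, huN₁⟩ :=
    aux h₁ hh₁
  obtain ⟨hE₂, hQ₂, hx₂, ⟨w₂, hw₂, hwN₂⟩, y₂, hy₂, hyx₂, hyN₂, g₂, hg₂, hgh₂, hyg₂, u₂, hu₂, huN₂⟩ :=
    aux h₂ hh₂
  obtain ⟨hE₃, hQ₃, hx₃, ⟨w₃, hw₃, hwN₃⟩, y₃, hy₃, hyx₃, hyN₃, g₃, hg₃, hgh₃, hyg₃, u₃, hu₃, huN₃⟩ :=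
    aux h₃ hh₃
  obtain ⟨hw₂v, f, hfE, hvf, hw₂f⟩ := mem_nbrs.1 hwN₂
  -- `w₂ ~ u₁ ~ w₃` and `w₂ ~ u₃ ~ w₁`
  have hu₁f : u₁ ∈ f := hE.mem_of_path hve hQ₂ hQ₁ hg₁ hx₂ hx₁ hy₁ hyg₁ hyx₁.symm hxN hyN₁
    h12.symm hgh₁ hw₂ hwN₂ hu₁ huN₁ hfE hvf hw₂f
  have hu₃f : u₃ ∈ f := hE.mem_of_path hve hQ₂ hQ₃ hg₃ hx₂ hx₃ hy₃ hyg₃ hyx₃.symm hxN hyN₃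
    h23 hgh₃ hw₂ hwN₂ hu₃ huN₃ hfE hvf hw₂f
  have hw₃f : w₃ ∈ f := hE.mem_of_path hve hg₁ hQ₁ hQ₃ hyg₁ hy₁ hx₁ hx₃ hyx₁ hyN₁ hxN
    hgh₁ h13.symm hu₁ huN₁ hw₃ hwN₃ hfE hvf hu₁f
  have hw₁f : w₁ ∈ f := hE.mem_of_path hve hg₃ hQ₃ hQ₁ hyg₃ hy₃ hx₃ hx₁ hyx₃ hyN₃ hxN
    hgh₃ h13 hu₃ huN₃ hw₁ hwN₁ hfE hvf hu₃f
  have hne : ∀ {h h' : Finset V} {w w' : V}, h ∈ E → h' ∈ E → h ≠ h' → x ∈ h → x ∈ h' → w ∈ h →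
      w' ∈ h' → w ∈ nbrs E v → w ≠ w' := by
    rintro h h' w _ hhE hhE' hhh' hxh hxh' hw hw' hwN rfl
    exact hhh' (hE.eq_of_mem hhE hhE' (by rintro rfl; exact hxN hwN) hxh hw hxh' hw')
  have hsub : ({v, w₁, w₂, w₃} : Finset V) ⊆ f := by
    simp [insert_subset_iff, *]
  have hcard : #({v, w₁, w₂, w₃} : Finset V) = 4 := by
    have a1 := hne hE₁ hE₂ h12 hx₁ hx₂ hw₁ hw₂ hwN₁
    have a2 := hne hE₁ hE₃ h13 hx₁ hx₃ hw₁ hw₃ hwN₁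
    have a3 := hne hE₂ hE₃ h23 hx₂ hx₃ hw₂ hw₃ hwN₂
    have a4 := (mem_nbrs.1 hwN₁).1
    have a5 := (mem_nbrs.1 hwN₃).1
    rw [card_insert_of_notMem, card_insert_of_notMem, card_insert_of_notMem, card_singleton] <;>
      simp [a1, a2, a3, a4.symm, a5.symm, hw₂v.symm]
  have := card_le_card hsub
  rw [hcard, hE.card_eq f hfE] at this
  omega

theorem charge_eq_zero [Fintype V] (hx : ∀ h ∈ outerTriples E e v, x ∉ far E v h) :
    charge E e v x = 0 := by
  rw [charge, filter_eq_empty_iff.2 (fun h hh => hx h hh), sum_empty]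

theorem PentagonFree.charge_le_two [Fintype V] (hE : PentagonFree E) (hve : v ∈ e) :
    charge E e v x ≤ 2 := by
  by_cases hxN : x ∈ nbrs E v
  · rw [charge_eq_zero fun h _ hx => (mem_far.1 hx).2 hxN]
    norm_num
  by_cases hxL : x ∈ heavy E e v
  -- A heavy vertex receives 1 from a triple whose far vertices are both heavy, and nothing from any
  -- other.
  · have h1 : charge E e v x ≤ ∑ h ∈ outerTriples E e v with x ∈ far E v h,
        if far E v h ⊆ heavy E e v then 1 else 0 := by
      refine sum_le_sum fun h hh => ?_
      rw [mem_filter] at hh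
      have h2 := hE.card_far hh.1
      have h3 := card_le_card (inter_subset_left (s₁ := far E v h) (s₂ := heavy E e v))
      rw [if_pos hxL]
      split_ifs with h4
      · omega
      · have h5 : far E v h ∩ heavy E e v ≠ far E v h := fun h => h4 (inter_eq_left.1 h)
        have h6 := card_lt_card (inter_subset_left.ssubset_of_ne h5)
        omega
    refine h1.trans ?_
    rw [sum_boole, filter_filter]
    have h2 := hE.card_heavyTriples_le hve hxN
    simp only [mem_far, hxN, not_false_eq_true, and_true]
    exact_mod_cast h2
  -- A vertex that is not heavy meets at most one outer triple, which gives it at most 2.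
  · have h1 : #{h ∈ outerTriples E e v | x ∈ far E v h} ≤ 1 := by
      simp only [mem_far, hxN, not_false_eq_true, and_true]
      simp only [heavy, mem_filter, mem_univ, hxN, true_and, not_false_eq_true] at hxL
      omega
    have h2 : charge E e v x ≤ #{h ∈ outerTriples E e v | x ∈ far E v h} • 2 := by
      refine sum_le_card_nsmul _ _ _ fun h hh => ?_
      rw [mem_filter] at hh
      have h2 := hE.card_far hh.1
      have h5 : far E v h ∩ heavy E e v ⊂ far E v h :=
        inter_subset_left.ssubset_of_ne fun h => hxL (inter_eq_left.1 h hh.2)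
      have h6 := card_lt_card h5
      rw [if_neg hxL]
      omega
    rw [nsmul_eq_mul] at h2
    omega

/-- If every far vertex of `h` lies in no other outer triple, then its charge is `1`. -/
theorem charge_eq_one [Fintype V] (hh : h ∈ outerTriples E e v) (hx : x ∈ far E v h)
    (huniq : ∀ y ∈ far E v h, ∀ g ∈ outerTriples E e v, y ∈ g → g = h) :
    charge E e v x = 1 := by
  have h1 : {g ∈ outerTriples E e v | x ∈ far E v g} = {h} := by
    ext g
    simp only [mem_filter, mem_singleton]
    refine ⟨fun hg => huniq x hx g hg.1 (mem_far.1 hg.2).1, ?_⟩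
    rintro rfl
    exact ⟨hh, hx⟩
  have h2 : ∀ y ∈ far E v h, y ∉ heavy E e v := by
    intro y hy hyL
    rw [heavy, mem_filter] at hyL
    obtain ⟨g, hg, hgh⟩ := exists_mem_ne hyL.2.2 h
    rw [mem_filter] at hg
    exact hgh (huniq y hy g hg.1 hg.2)
  rw [charge, h1, sum_singleton, if_neg (h2 x hx), disjoint_iff_inter_eq_empty.1 (disjoint_left.2 h2)]
  simp

end

/-! ### Combining the three vertices of a triple; the degree-product inequality -/

section
open Finset

variable {V : Type*} [DecidableEq V]
variable {E : Finset (Finset V)} {v x p q s : V} {e h h' : Finset V}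

/-- Two different triples would give a pentagon `p w x w' q`, closed by `e` itself. -/
theorem PentagonFree.eq_of_mem_outerTriples (hE : PentagonFree E) (he : e ∈ E) (hp : p ∈ e)
    (hq : q ∈ e) (hpq : p ≠ q) (hh : h ∈ outerTriples E e p) (hh' : h' ∈ outerTriples E e q)
    (hx : x ∈ h) (hx' : x ∈ h') (hxp : x ∉ nbrs E p) (hxq : x ∉ nbrs E q) : h = h' := by
  obtain ⟨w, hw, hwN, -⟩ := exists_of_mem_outerTriples hh
  obtain ⟨w', hw', hwN', -⟩ := exists_of_mem_outerTriples hh'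
  rw [mem_outerTriples] at hh hh'
  by_contra hne
  have hww' : w ≠ w' := by
    rintro rfl
    exact hne (hE.eq_of_mem hh.1 hh'.1 (by rintro rfl; exact hxp hwN) hx hw hx' hw')
  obtain ⟨hwp, f, hf, hpf, hwf⟩ := mem_nbrs.1 hwN
  obtain ⟨hwq, f', hf', hqf', hwf'⟩ := mem_nbrs.1 hwN'
  have hph : ∀ u ∈ e, u ∉ h := fun _ hu => disjoint_right.1 hh.2.1 hu
  have hph' : ∀ u ∈ e, u ∉ h' := fun _ hu => disjoint_right.1 hh'.2.1 hu
  have hff' : f ≠ f' := by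
    rintro rfl
    have := hE.eq_of_mem hf he hpq hpf hqf' hp hq
    exact hph w (this ▸ hwf) hw
  refine hE.no_pentagon (v₁ := p) (v₂ := w) (v₃ := x) (v₄ := w') (v₅ := q) ?_ ?_
    hf hh.1 hh'.1 hf' he hpf hwf hw hx hx' hw' hwf' hqf' hq hp
  · simp only [List.nodup_cons, List.mem_cons, List.not_mem_nil, or_false, not_or]
    grind
  · simp only [List.nodup_cons, List.mem_cons, List.not_mem_nil, or_false, not_or]
    grind

/-- The vertices `x` of triples `{x, y, z}` disjoint from `e` such that `y` is a common neighbour of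
`p` and `q`, and `z` is a neighbour of `s`. -/
noncomputable def crossing [Fintype V] (E : Finset (Finset V)) (e : Finset V) (p q s : V) :
    Finset V :=
  open scoped Classical in
  {x | ∃ z ∈ nbrs E s, ∃ h ∈ E, Disjoint h e ∧ x ∈ h ∧ z ∈ h ∧ z ≠ x ∧ x ∉ nbrs E p ∧
    ∃ y ∈ h, y ≠ z ∧ y ∈ nbrs E p ∧ y ∈ nbrs E q}

/-- The witness `z ∈ nbrs E s` determines `x`: two triples through `z` with different `y, y'` would
form the pentagon `p y z y' q`, while a common `y` forces a common triple, of which `x` is the third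
vertex. -/
theorem PentagonFree.card_crossing_le [Fintype V] (hE : PentagonFree E) (he : e ∈ E) (hp : p ∈ e)
    (hq : q ∈ e) (hpq : p ≠ q) : #(crossing E e p q s) ≤ 2 * deg E s := by
  rw [← hE.card_nbrs]
  refine card_le_card_of_forall_subsingleton (fun x z => ∃ h ∈ E, Disjoint h e ∧ x ∈ h ∧ z ∈ h ∧
    z ≠ x ∧ x ∉ nbrs E p ∧ ∃ y ∈ h, y ≠ z ∧ y ∈ nbrs E p ∧ y ∈ nbrs E q) ?_ ?_
  · intro x hx
    simpa [crossing] using hx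
  · rintro z - x ⟨-, h, hhE, hhe, hx, hz, hzx, hxp, y, hy, hyz, hyp, hyq⟩
      x' ⟨-, h', hhE', hhe', hx', hz', hzx', hxp', y', hy', hyz', hyp', hyq'⟩
    have hxy : x ≠ y := by rintro rfl; exact hxp hyp
    have hxy' : x' ≠ y' := by rintro rfl; exact hxp' hyp'
    by_cases hyy' : y = y'
    · subst hyy'
      have := hE.eq_of_mem hhE hhE' hyz hy hz hy' hz'
      subst this
      by_contra hne
      have h1 : ({x, x', y, z} : Finset V) ⊆ h := by simp [insert_subset_iff, *]
      have h2 := card_le_card h1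
      rw [hE.card_eq h hhE, card_insert_of_notMem, card_insert_of_notMem, card_insert_of_notMem,
        card_singleton] at h2
      · omega
      all_goals simp [*, hzx.symm, hzx'.symm]
    · exfalso
      have hph : ∀ u ∈ e, u ∉ h := fun _ hu => disjoint_right.1 hhe hu
      have hph' : ∀ u ∈ e, u ∉ h' := fun _ hu => disjoint_right.1 hhe' hu
      have hhh' : h ≠ h' := by
        rintro rfl
        have h1 : ({x, y, y', z} : Finset V) ⊆ h := by simp [insert_subset_iff, *]
        have hxy'' : x ≠ y' := by rintro rfl; exact hxp hyp'
        have h2 := card_le_card h1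
        rw [hE.card_eq h hhE, card_insert_of_notMem, card_insert_of_notMem, card_insert_of_notMem,
          card_singleton] at h2
        · omega
        all_goals simp [*, hzx.symm]
      obtain ⟨hyp0, f, hf, hpf, hyf⟩ := mem_nbrs.1 hyp
      obtain ⟨hyq0, f', hf', hqf', hyf'⟩ := mem_nbrs.1 hyq'
      have hff' : f ≠ f' := by
        rintro rfl
        have := hE.eq_of_mem hf he hpq hpf hqf' hp hq
        exact hph y (this ▸ hyf) hy
      refine hE.no_pentagon (v₁ := p) (v₂ := y) (v₃ := z) (v₄ := y') (v₅ := q) ?_ ?_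
        hf hhE hhE' hf' he hpf hyf hy hz hz' hy' hyf' hqf' hq hp
      · simp only [List.nodup_cons, List.mem_cons, List.not_mem_nil, or_false, not_or]
        grind
      · simp only [List.nodup_cons, List.mem_cons, List.not_mem_nil, or_false, not_or]
        grind

/-- If some charge vanishes, the other two are at most 2 each. Otherwise one triple `h` serves `a`,
`b` and `c`. Outside the crossing sets its neighbours of `a`, `b`, `c` coincide; its far vertices
then lie in no other outer triple, and each charge is 1. -/
theorem PentagonFree.charge_add_charge_add_charge_le [Fintype V] (hE : PentagonFree E) {a b c : V}
    (he : {a, b, c} ∈ E) (hab : a ≠ b) (hac : a ≠ c) (hbc : b ≠ c) (x : V)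
    (hx₁ : x ∉ crossing E {a, b, c} a b c) (hx₂ : x ∉ crossing E {a, b, c} a c b)
    (hx₃ : x ∉ crossing E {a, b, c} b c a) :
    charge E {a, b, c} a x + charge E {a, b, c} b x + charge E {a, b, c} c x ≤ 4 := by
  have ha : a ∈ ({a, b, c} : Finset V) := by simp
  have hb : b ∈ ({a, b, c} : Finset V) := by simp
  have hc : c ∈ ({a, b, c} : Finset V) := by simp
  generalize ({a, b, c} : Finset V) = e at *
  have ha2 := hE.charge_le_two ha (x := x)
  have hb2 := hE.charge_le_two hb (x := x)
  have hc2 := hE.charge_le_two hc (x := x)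
  by_cases hxa : ∀ h ∈ outerTriples E e a, x ∉ far E a h
  · rw [charge_eq_zero hxa]; omega
  by_cases hxb : ∀ h ∈ outerTriples E e b, x ∉ far E b h
  · rw [charge_eq_zero hxb]; omega
  by_cases hxc : ∀ h ∈ outerTriples E e c, x ∉ far E c h
  · rw [charge_eq_zero hxc]; omega
  push Not at hxa hxb hxc
  obtain ⟨h, hha, hxa⟩ := hxa
  obtain ⟨h₂, hhb, hxb⟩ := hxb
  obtain ⟨h₃, hhc, hxc⟩ := hxc
  have hxa' := mem_far.1 hxa
  have hxb' := mem_far.1 hxb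
  have hxc' := mem_far.1 hxc
  obtain rfl := hE.eq_of_mem_outerTriples he ha hb hab hha hhb hxa'.1 hxb'.1 hxa'.2 hxb'.2
  obtain rfl := hE.eq_of_mem_outerTriples he ha hc hac hha hhc hxa'.1 hxc'.1 hxa'.2 hxc'.2
  obtain ⟨wa, hwa, hwaN, hwa'⟩ := exists_of_mem_outerTriples hha
  obtain ⟨wb, hwb, hwbN, hwb'⟩ := exists_of_mem_outerTriples hhb
  obtain ⟨wc, hwc, hwcN, hwc'⟩ := exists_of_mem_outerTriples hhc
  have hxwa : wa ≠ x := by rintro rfl; exact hxa'.2 hwaN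
  have hxwb : wb ≠ x := by rintro rfl; exact hxb'.2 hwbN
  have hxwc : wc ≠ x := by rintro rfl; exact hxc'.2 hwcN
  obtain ⟨hhE, hhe, -⟩ := mem_outerTriples.1 hha
  simp only [crossing, mem_filter, mem_univ, true_and] at hx₁ hx₂ hx₃
  by_cases h12 : wa = wb
  · subst h12
    by_cases h13 : wa = wc
    · subst h13
      have key : ∀ p q, p ∈ e → q ∈ e → p ≠ q → h ∈ outerTriples E e p → h ∈ outerTriples E e q →
          (∀ y ∈ h, y ∈ nbrs E q → y = wa) → wa ∈ nbrs E p → x ∈ far E p h →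
          charge E e p x = 1 := by
        intro p q hp hq hpq hhp hhq hwq hwp hxp
        refine charge_eq_one hhp hxp fun y hy g hg hyg => ?_
        rw [mem_far] at hy
        refine hE.eq_of_mem_outerTriples he hp hq hpq hg hhq hyg hy.1 hy.2 fun hyq => ?_
        exact hy.2 (hwq y hy.1 hyq ▸ hwp)
      rw [key a b ha hb hab hha hhb hwb' hwaN hxa, key b c hb hc hbc hhb hhc hwc' hwbN hxb,
        key c a hc ha hac.symm hhc hha hwa' hwcN hxc]
      norm_num
    · exact absurd ⟨wc, hwcN, h, hhE, hhe, hxa'.1, hwc, hxwc, hxa'.2, wa, hwa, h13, hwaN, hwbN⟩ hx₁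
  · by_cases h13 : wa = wc
    · subst h13
      exact absurd ⟨wb, hwbN, h, hhE, hhe, hxa'.1, hwb, hxwb, hxa'.2, wa, hwa, h12, hwaN, hwcN⟩ hx₂
    · by_cases h23 : wb = wc
      · subst h23
        exact absurd ⟨wa, hwaN, h, hhE, hhe, hxa'.1, hwa, hxwa, hxb'.2, wb, hwb, Ne.symm h12, hwbN,
          hwcN⟩ hx₃
      · exfalso
        have h1 : ({x, wa, wb, wc} : Finset V) ⊆ h := by simp [insert_subset_iff, *]
        have h2 := card_le_card h1
        rw [hE.card_eq h hhE, card_insert_of_notMem, card_insert_of_notMem, card_insert_of_notMem,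
          card_singleton] at h2
        · omega
        all_goals simp [*, hxwa.symm, hxwb.symm, hxwc.symm]

theorem PentagonFree.sum_card_outerTriples_le [Fintype V] (hE : PentagonFree E) (he : e ∈ E) :
    ∑ v ∈ e, #(outerTriples E e v) ≤ 2 * Fintype.card V + 2 * ∑ v ∈ e, deg E v := by
  obtain ⟨a, b, c, hab, hac, hbc, rfl⟩ := card_eq_three.1 (hE.card_eq e he)
  have ha : a ∈ ({a, b, c} : Finset V) := by simp
  have hb : b ∈ ({a, b, c} : Finset V) := by simp
  have hc : c ∈ ({a, b, c} : Finset V) := by simp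
  have c1 := hE.card_crossing_le he ha hb hab (s := c)
  have c2 := hE.card_crossing_le he ha hc hac (s := b)
  have c3 := hE.card_crossing_le he hb hc hbc (s := a)
  rw [sum_insert (by simp [hab, hac]), sum_insert (by simp [hbc]), sum_singleton,
    sum_insert (by simp [hab, hac]), sum_insert (by simp [hbc]), sum_singleton]
  set B := crossing E {a, b, c} a b c ∪ crossing E {a, b, c} a c b ∪ crossing E {a, b, c} b c a
    with hB
  have hBc : #B ≤ 2 * deg E c + 2 * deg E b + 2 * deg E a :=
    (card_union_le _ _).trans (add_le_add ((card_union_le _ _).trans (add_le_add c1 c2)) c3)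
  have h1 : ∑ x, (charge E {a, b, c} a x + charge E {a, b, c} b x + charge E {a, b, c} c x) ≤
      ∑ x : V, (4 + if x ∈ B then 2 else 0 : ℤ) := by
    refine sum_le_sum fun x _ => ?_
    split_ifs with hx
    · have ha2 := hE.charge_le_two ha (x := x)
      have hb2 := hE.charge_le_two hb (x := x)
      have hc2 := hE.charge_le_two hc (x := x)
      omega
    · simp only [hB, mem_union, not_or] at hx
      rw [add_zero]
      exact hE.charge_add_charge_add_charge_le he hab hac hbc x hx.1.1 hx.1.2 hx.2
  rw [sum_add_distrib, sum_add_distrib, hE.sum_charge, hE.sum_charge, hE.sum_charge,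
    sum_add_distrib, ← sum_filter, filter_mem_eq_inter, univ_inter, sum_const, sum_const,
    card_univ, nsmul_eq_mul, nsmul_eq_mul] at h1
  omega

/-- Count incidences of triples with `nbrs E v`. A triple through `v` contributes at most 2 and an
inner triple at most 3, giving `2 + 3 * 6 = 20`; any other contributing triple has one neighbour,
and is either outer or meets `e`. -/
theorem PentagonFree.sum_nbrs_deg_le (hE : PentagonFree E) (e : Finset V) (v : V) :
    ∑ w ∈ nbrs E v, deg E w ≤
      #(outerTriples E e v) + 20 * deg E v + ∑ u ∈ e, deg E u := by
  have h1 : ∀ s : Finset V, ∑ w ∈ s, deg E w = ∑ h ∈ E, #(h ∩ s) := by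
    intro s
    simp only [deg, card_filter]
    rw [sum_comm]
    refine sum_congr rfl fun h _ => ?_
    rw [← card_filter, filter_mem_eq_inter, inter_comm]
  rw [h1, h1]
  have h2 : ∑ h ∈ E, #(h ∩ nbrs E v) ≤ ∑ h ∈ E, ((if Disjoint h e ∧ #(h ∩ nbrs E v) = 1 then 1 else 0)
      + 2 * (if v ∈ h then 1 else 0) + 3 * (if v ∉ h ∧ 2 ≤ #(h ∩ nbrs E v) then 1 else 0)
      + #(h ∩ e)) := by
    refine sum_le_sum fun h hh => ?_
    have h3 := hE.card_eq h hh
    have h4 := card_le_card (inter_subset_left (s₁ := h) (s₂ := nbrs E v))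
    by_cases hvh : v ∈ h
    · have h5 : h ∩ nbrs E v ⊆ h.erase v := fun y hy =>
        mem_erase.2 ⟨(mem_nbrs.1 (mem_inter.1 hy).2).1, (mem_inter.1 hy).1⟩
      have h6 := card_le_card h5
      rw [card_erase_of_mem hvh] at h6
      rw [if_pos hvh]
      omega
    · by_cases h5 : 2 ≤ #(h ∩ nbrs E v)
      · rw [if_pos (show v ∉ h ∧ 2 ≤ #(h ∩ nbrs E v) from ⟨hvh, h5⟩)]
        omega
      · by_cases h6 : Disjoint h e
        · by_cases h7 : #(h ∩ nbrs E v) = 1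
          · rw [if_pos (show Disjoint h e ∧ #(h ∩ nbrs E v) = 1 from ⟨h6, h7⟩)]
            omega
          · omega
        · rw [disjoint_iff_inter_eq_empty, ← card_eq_zero] at h6
          omega
  refine h2.trans ?_
  rw [sum_add_distrib, sum_add_distrib, sum_add_distrib, ← mul_sum, ← mul_sum, ← card_filter,
    ← card_filter, ← card_filter]
  have h3 := hE.card_innerTriples_le v
  rw [innerTriples] at h3
  rw [outerTriples]
  simp only [deg] at h3 ⊢
  omega

theorem sum_triples_sum [Fintype V] (F : V → ℕ) :
    ∑ e ∈ E, ∑ v ∈ e, F v = ∑ v, deg E v * F v := by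
  simp only [deg, card_filter, sum_mul]
  rw [sum_comm]
  refine sum_congr rfl fun e _ => ?_
  simp only [ite_mul, one_mul, zero_mul]
  rw [← sum_filter, filter_mem_eq_inter, univ_inter]

/-- For each triple the degree sum appears `2` times from the crossing sets, `20` from the local
count and `3` from the repeated sum over `e`, hence `25`. -/
theorem PentagonFree.sum_deg_mul_sum_deg_le [Fintype V] (hE : PentagonFree E) :
    ∑ v, deg E v * ∑ w ∈ nbrs E v, deg E w ≤
      2 * Fintype.card V * #E + 25 * ∑ v, deg E v * deg E v := by
  rw [← sum_triples_sum, ← sum_triples_sum, mul_comm _ #E, mul_sum, ← smul_eq_mul, ← sum_const,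
    ← sum_add_distrib]
  refine sum_le_sum fun e he => ?_
  refine (sum_le_sum fun v _ => hE.sum_nbrs_deg_le e v).trans ?_
  rw [sum_add_distrib, sum_add_distrib, sum_const, hE.card_eq e he, ← mul_sum]
  have := hE.sum_card_outerTriples_le he
  rw [smul_eq_mul]
  omega

end

end TripleSystem

/-! ### The lower-bound construction -/

namespace GridHypergraph

/-- The axis-parallel lines of the cube `(Fin 3 → Fin d)`: a direction together with the
coordinates in the other directions. -/
abbrev Line (d : ℕ) := Σ s : Fin 3, ({t : Fin 3 // t ≠ s} → Fin d)

/-- The line through `p` in direction `s`. -/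
def line {d : ℕ} (p : Fin 3 → Fin d) (s : Fin 3) : Line d := ⟨s, fun t => p t⟩

theorem card_line (d : ℕ) : Fintype.card (Line d) = 3 * d ^ 2 := by
  simp [Fintype.card_sigma, Fintype.card_subtype_compl]

variable {d : ℕ} {p q : Fin 3 → Fin d} {s t : Fin 3}

theorem line_eq_line : line p s = line q t ↔ s = t ∧ ∀ r, r ≠ s → p r = q r := by
  constructor
  · intro h
    obtain rfl : s = t := congrArg Sigma.fst h
    refine ⟨rfl, fun r hr => ?_⟩
    have := eq_of_heq (Sigma.mk.inj h).2
    exact congrFun this ⟨r, hr⟩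
  · rintro ⟨rfl, h⟩
    exact Sigma.ext rfl (heq_of_eq (funext fun r => h r r.2))

-- A proper 3-colouring of a 5-cycle uses each colour at most twice, so its class sizes are 2, 2, 1.
set_option maxRecDepth 100000 in
theorem exists_unique_colour : ∀ s : Fin 5 → Fin 3, (∀ i, s (finRotate 5 i) ≠ s i) →
    ∃ i, ∀ j, j ≠ i → s j ≠ s i := by
  decide

variable {α : Type*} (ι : Line d ↪ α)

/-- The set of (images under `ι` of) lines through the point `p`. -/
def pencil (p : Fin 3 → Fin d) : Set α := Set.range fun s => ι (line p s)

theorem eq_of_mem_pencil {a b : α} (hab : a ≠ b) (hap : a ∈ pencil ι p) (hbp : b ∈ pencil ι p)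
    (haq : a ∈ pencil ι q) (hbq : b ∈ pencil ι q) : p = q := by
  obtain ⟨s, rfl⟩ := hap
  obtain ⟨t, rfl⟩ := hbp
  obtain ⟨s', hs⟩ := haq
  obtain ⟨t', ht⟩ := hbq
  obtain ⟨rfl, hs'⟩ := line_eq_line.1 (ι.injective hs)
  obtain ⟨rfl, ht'⟩ := line_eq_line.1 (ι.injective ht)
  have hst : s' ≠ t' := by rintro rfl; exact hab rfl
  funext r
  by_cases hr : r = s'
  · exact (ht' r (hr ▸ hst)).symm
  · exact (hs' r hr).symm

theorem encard_pencil (p : Fin 3 → Fin d) : (pencil ι p).encard = 3 := by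
  have hinj : Function.Injective fun s => ι (line p s) := fun s t h =>
    (line_eq_line.1 (ι.injective h)).1
  rw [pencil, ← Set.image_univ, hinj.encard_image]
  simp

theorem pencil_injective : Function.Injective (pencil ι) := by
  intro p q h
  have h0 : ι (line p 0) ∈ pencil ι p := ⟨0, rfl⟩
  have h1 : ι (line p 1) ∈ pencil ι p := ⟨1, rfl⟩
  refine eq_of_mem_pencil ι ?_ h0 h1 (h ▸ h0) (h ▸ h1)
  intro h
  exact absurd (line_eq_line.1 (ι.injective h)).1 (by decide)

/-- The hypergraph of axis-parallel lines whose hyperedges are the points of the cube. -/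
def grid : Hypergraph α where
  vertexSet := Set.univ
  edgeSet := Set.range (pencil ι)
  subset_vertexSet_of_mem_edgeSet' _ _ := Set.subset_univ _

theorem grid_isUniform : (grid ι).IsUniform 3 := by
  rintro _ ⟨p, rfl⟩
  exact encard_pencil ι p

theorem grid_isLinear : (grid ι).IsLinear := by
  rintro _ ⟨p, rfl⟩ _ ⟨q, rfl⟩ hpq
  rw [Set.encard_le_one_iff]
  rintro a b ⟨hap, haq⟩ ⟨hbp, hbq⟩
  by_contra hab
  exact hpq (congrArg _ (eq_of_mem_pencil ι hab hap hbp haq hbq))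

/-- A Berge 5-cycle is a closed walk of five points along lines, consecutive steps having different
directions. Some direction is used exactly once; since the walk closes up, that coordinate cannot
change on that step, so two consecutive points coincide. -/
theorem grid_not_hasBergeCycle : ¬ (grid ι).HasBergeCycle 5 := by
  rintro ⟨v, h, hv, hh, hE, hvh, hvh'⟩
  choose p hp using hE
  have hrot : ∀ i : Fin 5, finRotate 5 i ≠ i := by decide
  have hpne : ∀ i, p (finRotate 5 i) ≠ p i := by
    intro i hi
    have : h (finRotate 5 i) = h i := by rw [← hp, ← hp, hi]
    exact hrot i (hh this)
  simp only [← hp] at hvh hvh'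
  choose s hs using hvh
  choose s' hs' using hvh'
  have hstep : ∀ i, s' i = s (finRotate 5 i) ∧
      ∀ r, r ≠ s (finRotate 5 i) → p (finRotate 5 i) r = p i r := by
    intro i
    have := line_eq_line.1 (ι.injective ((hs' i).trans (hs (finRotate 5 i)).symm))
    exact ⟨this.1, fun r hr => (this.2 r (this.1 ▸ hr)).symm⟩
  have hne : ∀ i, s (finRotate 5 i) ≠ s i := by
    intro i hi
    have h1 := hs' i
    rw [(hstep i).1, hi] at h1
    exact hrot i (hv (h1.symm.trans (hs i)))
  obtain ⟨i, hi⟩ := exists_unique_colour s hne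
  have h1 : ∀ j, finRotate 5 j ≠ i → p (finRotate 5 j) (s i) = p j (s i) := fun j hj =>
    (hstep j).2 _ (hi _ hj).symm
  have h2 : ∀ (f : Fin 5 → Fin d) (i : Fin 5),
      (∀ j, finRotate 5 j ≠ i → f (finRotate 5 j) = f j) → ∀ j k, f j = f k := by
    intro f i hf
    have e0 := hf 0
    have e1 := hf 1
    have e2 := hf 2
    have e3 := hf 3
    have e4 := hf 4
    simp only [show finRotate 5 0 = 1 by decide, show finRotate 5 1 = 2 by decide,
      show finRotate 5 2 = 3 by decide, show finRotate 5 3 = 4 by decide,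
      show finRotate 5 4 = 0 by decide] at e0 e1 e2 e3 e4
    have hall : ∀ j, f j = f 0 := by
      intro j
      fin_cases i <;> fin_cases j <;> simp_all
    intro j k
    rw [hall j, hall k]
  obtain ⟨j, rfl⟩ := (finRotate 5).surjective i
  refine hpne j (funext fun r => ?_)
  by_cases hr : r = s (finRotate 5 j)
  · subst hr
    exact h2 (fun k => p k (s (finRotate 5 j))) _ h1 _ _
  · exact (hstep j).2 r hr

theorem ncard_edgeSet_grid : (grid ι).edgeSet.ncard = d ^ 3 := by
  change (Set.range (pencil ι)).ncard = _
  rw [← Set.image_univ, Set.ncard_image_of_injective _ (pencil_injective ι), Set.ncard_univ]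
  simp

end GridHypergraph

theorem pow_three_le_linearTuran {n d : ℕ} (h : 3 * d ^ 2 ≤ n) : d ^ 3 ≤ linearTuran n 5 := by
  obtain ⟨ι⟩ : Nonempty (GridHypergraph.Line d ↪ Fin n) :=
    Function.Embedding.nonempty_of_card_le (by
      rw [GridHypergraph.card_line, Fintype.card_fin]
      exact h)
  exact (linearTuran_isGreatest n 5 (by norm_num)).2
    ⟨GridHypergraph.grid ι, rfl, GridHypergraph.grid_isUniform ι, GridHypergraph.grid_isLinear ι,
      GridHypergraph.grid_not_hasBergeCycle ι, GridHypergraph.ncard_edgeSet_grid ι⟩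

/-! ### From the degree-product inequality to the upper bound -/

namespace TripleSystem

section
open Finset

/-- AM-GM, with equality at `u = v = t`. Passing to square roots makes the difference an explicit
nonnegative expression. -/
theorem three_mul_sq_le {u v t : ℝ} (hu : 0 < u) (hv : 0 < v) (ht : 0 < t) :
    3 * t ^ 2 ≤ u * v + t ^ 3 / u + t ^ 3 / v := by
  obtain ⟨a, ha, rfl⟩ : ∃ a : ℝ, 0 < a ∧ u = a ^ 2 :=
    ⟨√u, Real.sqrt_pos.2 hu, (Real.sq_sqrt hu.le).symm⟩
  obtain ⟨b, hb, rfl⟩ : ∃ b : ℝ, 0 < b ∧ v = b ^ 2 :=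
    ⟨√v, Real.sqrt_pos.2 hv, (Real.sq_sqrt hv.le).symm⟩
  have h1 : a ^ 2 * b ^ 2 + t ^ 3 / a ^ 2 + t ^ 3 / b ^ 2 - 3 * t ^ 2 =
      (t ^ 3 * (a - b) ^ 2 + a * b * (a * b - t) ^ 2 * (a * b + 2 * t)) / (a ^ 2 * b ^ 2) := by
    field_simp
    ring
  have h2 : 0 ≤ (t ^ 3 * (a - b) ^ 2 + a * b * (a * b - t) ^ 2 * (a * b + 2 * t)) /
      (a ^ 2 * b ^ 2) := by positivity
  linarith

/-- The shift by 7 will absorb the `25 ∑ d(v)²` error. The bound 14 gives `Z ≤ 2(Z - 7)`, so when `Z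
> t/3` replacing `Z` by `Z - 7` in a reciprocal costs at most `126t`; when `Z ≤ t/3`, the term
`t³/Z` suffices alone. -/
theorem three_mul_sq_sub_le {X Y t : ℝ} (hX : 14 ≤ X) (hY : 14 ≤ Y) (ht : 0 < t) :
    3 * t ^ 2 - 252 * t ≤ (X - 7) * (Y - 7) + t ^ 3 / X + t ^ 3 / Y := by
  have h0 : 0 ≤ (X - 7) * (Y - 7) := mul_nonneg (by linarith) (by linarith)
  have hX0 : 0 < X := by linarith
  have hY0 : 0 < Y := by linarith
  have hXt : 0 ≤ t ^ 3 / X := by positivity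
  have hYt : 0 ≤ t ^ 3 / Y := by positivity
  have small : ∀ {Z : ℝ}, 0 < Z → Z ≤ t / 3 → 3 * t ^ 2 ≤ t ^ 3 / Z := by
    intro Z hZ h
    rw [le_div_iff₀ hZ]
    nlinarith [sq_nonneg t]
  have large : ∀ {Z : ℝ}, 14 ≤ Z → t / 3 < Z → t ^ 3 / (Z - 7) - 126 * t ≤ t ^ 3 / Z := by
    intro Z hZ h
    have hZ0 : 0 < Z := by linarith
    have hZ7 : 0 < Z - 7 := by linarith
    have h1 : t ^ 3 / (Z - 7) - t ^ 3 / Z = 7 * t ^ 3 / ((Z - 7) * Z) := by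
      field_simp
      ring
    have h2 : 7 * t ^ 3 / ((Z - 7) * Z) ≤ 126 * t := by
      rw [div_le_iff₀ (by positivity)]
      have h3 : t ^ 2 ≤ 9 * Z ^ 2 := by nlinarith
      have h4 : Z ^ 2 ≤ 2 * ((Z - 7) * Z) := by nlinarith
      have h5 : t ^ 2 ≤ 18 * ((Z - 7) * Z) := by linarith
      nlinarith
    linarith
  rcases le_or_gt X (t / 3) with hXs | hXl
  · linarith [small hX0 hXs]
  rcases le_or_gt Y (t / 3) with hYs | hYl
  · linarith [small hY0 hYs]
  linarith [large hX hXl, large hY hYl,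
    three_mul_sq_le (u := X - 7) (v := Y - 7) (by linarith) (by linarith) ht]

variable {V : Type*} [DecidableEq V] {E : Finset (Finset V)}

/-- Deleting triples, few in number, makes all positive degrees large. -/
theorem exists_subset_forall_deg [Fintype V] (K : ℕ) (E : Finset (Finset V)) :
    ∃ F ⊆ E, (∀ v, deg F v = 0 ∨ K ≤ deg F v) ∧ #E ≤ #F + K * #{v | deg E v ≠ 0} := by
  induction E using Finset.strongInduction with
  | H E ih =>
    by_cases hE : ∀ v, deg E v = 0 ∨ K ≤ deg E v
    · exact ⟨E, Subset.rfl, hE, by omega⟩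
    push Not at hE
    obtain ⟨v, hv0, hvK⟩ := hE
    have hsplit := card_filter_add_card_filter_not (s := E) (fun e => v ∈ e)
    have hdeg : #{e ∈ E | v ∈ e} = deg E v := rfl
    have hss : {e ∈ E | v ∉ e} ⊂ E := by
      refine (filter_subset _ _).ssubset_of_ne fun h => ?_
      rw [h] at hsplit
      omega
    obtain ⟨F, hF, hFd, hFc⟩ := ih _ hss
    refine ⟨F, hF.trans hss.subset, hFd, ?_⟩
    -- Each round deletes fewer than `K` triples and isolates `v`, so the count of non-isolated
    -- vertices pays for it.
    have hlt : #{w | deg {e ∈ E | v ∉ e} w ≠ 0} < #{w | deg E w ≠ 0} := by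
      refine card_lt_card ((ssubset_iff_of_subset ?_).2 ⟨v, ?_, ?_⟩)
      · intro w hw
        simp only [mem_filter, mem_univ, true_and] at hw ⊢
        have : deg {e ∈ E | v ∉ e} w ≤ deg E w := card_le_card (filter_subset_filter _ hss.subset)
        omega
      · simpa using hv0
      · simp [deg, filter_filter, filter_eq_empty_iff]
    have := Nat.mul_le_mul_left K hlt
    rw [Nat.mul_succ] at this
    omega

theorem PentagonFree.sum_deg [Fintype V] (hE : PentagonFree E) : ∑ v, deg E v = 3 * #E := by
  have h := sum_triples_sum (E := E) (fun _ => 1)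
  simp only [mul_one, sum_const, smul_eq_mul] at h
  rw [← h, sum_congr rfl hE.card_eq, sum_const, smul_eq_mul, mul_comm]

/-- Sum the shifted pointwise inequality over the `6 * #E` ordered adjacent pairs. The linear terms
give `-28 ∑ d(v)²`, which outweighs the error `25 ∑ d(v)²`; the constant gives `49 * 6 = 294`. -/
theorem PentagonFree.card_mul_le [Fintype V] (hE : PentagonFree E)
    (hdeg : ∀ v, deg E v = 0 ∨ 14 ≤ deg E v) {t : ℝ} (ht : 0 < t) :
    6 * #E * (3 * t ^ 2 - 252 * t) ≤
      2 * Fintype.card V * #E + 294 * #E + 4 * Fintype.card V * t ^ 3 := by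
  have hswap : ∀ g : V → ℝ, ∑ v, ∑ w ∈ nbrs E v, g w = ∑ v, ∑ w ∈ nbrs E v, g v := by
    intro g
    refine sum_comm' fun v w => ?_
    simp [mem_nbrs_comm]
  have hconst : ∀ g : V → ℝ, ∑ v, ∑ w ∈ nbrs E v, g v = ∑ v, 2 * deg E v * g v := by
    intro g
    refine sum_congr rfl fun v _ => ?_
    rw [sum_const, hE.card_nbrs, nsmul_eq_mul]
    push_cast
    ring
  have hsum : ∑ v, (deg E v : ℝ) = 3 * #E := by exact_mod_cast hE.sum_deg
  have hmain : ∑ v, ∑ w ∈ nbrs E v, (deg E v * deg E w : ℝ) ≤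
      2 * Fintype.card V * #E + 25 * ∑ v, (deg E v * deg E v : ℝ) := by
    simp only [← mul_sum]
    exact_mod_cast hE.sum_deg_mul_sum_deg_le
  have hS : 0 ≤ ∑ v, (deg E v * deg E v : ℝ) := sum_nonneg fun v _ => mul_self_nonneg _
  have hdS : ∑ v, 2 * deg E v * (deg E v : ℝ) = 2 * ∑ v, (deg E v * deg E v : ℝ) := by
    rw [mul_sum]
    exact sum_congr rfl fun v _ => mul_assoc _ _ _
  have hinv : ∑ v, 2 * deg E v * (t ^ 3 / deg E v) ≤ Fintype.card V * (2 * t ^ 3) := by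
    rw [← nsmul_eq_mul, ← card_univ, ← sum_const]
    refine sum_le_sum fun v _ => ?_
    rcases eq_or_ne (deg E v : ℝ) 0 with h | h
    · rw [h]
      simp only [mul_zero, zero_mul]
      positivity
    · exact le_of_eq (by field_simp)
  have hone : ∑ v, ∑ w ∈ nbrs E v, (3 * t ^ 2 - 252 * t) = 6 * #E * (3 * t ^ 2 - 252 * t) := by
    rw [hconst (fun _ => 3 * t ^ 2 - 252 * t), ← sum_mul, ← mul_sum, hsum]
    ring
  have hone' : ∑ v, ∑ w ∈ nbrs E v, (49 : ℝ) = 6 * #E * 49 := by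
    rw [hconst (fun _ => 49), ← sum_mul, ← mul_sum, hsum]
    ring
  have hpt : ∑ v, ∑ w ∈ nbrs E v, (3 * t ^ 2 - 252 * t) ≤ ∑ v, ∑ w ∈ nbrs E v,
      ((deg E v * deg E w : ℝ) - 7 * deg E v - 7 * deg E w + 49 + t ^ 3 / deg E v +
        t ^ 3 / deg E w) := by
    refine sum_le_sum fun v _ => sum_le_sum fun w hw => ?_
    obtain ⟨-, e, he, hve, hwe⟩ := mem_nbrs.1 hw
    have hv : (14 : ℝ) ≤ deg E v := by
      refine mod_cast (hdeg v).resolve_left fun h => ?_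
      exact notMem_empty e (card_eq_zero.1 h ▸ mem_filter.2 ⟨he, hve⟩)
    have hw : (14 : ℝ) ≤ deg E w := by
      refine mod_cast (hdeg w).resolve_left fun h => ?_
      exact notMem_empty e (card_eq_zero.1 h ▸ mem_filter.2 ⟨he, hwe⟩)
    linarith [three_mul_sq_sub_le hv hw ht]
  rw [hone] at hpt
  simp only [sum_add_distrib, sum_sub_distrib, ← mul_sum _ _ (7 : ℝ)] at hpt
  rw [hone', hswap (fun v => (deg E v : ℝ)), hswap (fun v => t ^ 3 / (deg E v : ℝ)),
    hconst (fun v => (deg E v : ℝ)), hconst (fun v => t ^ 3 / (deg E v : ℝ)), hdS] at hpt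
  linarith

theorem PentagonFree.card_le [Fintype V] (hE : PentagonFree E) {t : ℝ}
    (ht : 300 ≤ t) (hV : (Fintype.card V : ℝ) = 3 * t ^ 2) :
    (#E : ℝ) ≤ t ^ 3 + 100 * Fintype.card V := by
  obtain ⟨F, hFE, hFd, hFc⟩ := exists_subset_forall_deg 14 E
  have h1 := (hE.mono hFE).card_mul_le hFd (t := t) (by linarith)
  have h2 : (#E : ℝ) ≤ #F + 14 * Fintype.card V := by
    have := card_le_univ ({v | deg E v ≠ 0} : Finset V)
    exact_mod_cast (show #E ≤ #F + 14 * Fintype.card V by omega)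
  rw [hV] at h1 h2 ⊢
  generalize (#F : ℝ) = m at *
  -- Any constant above 126 works for large `t`; with 254, adding the `14 * 3t²` deleted triples
  -- gives `296t²`, below `100 * 3t²`.
  have hm : m ≤ t ^ 3 + 254 * t ^ 2 := by
    by_contra! hcon
    have hm0 : 0 < m := lt_trans (by positivity) hcon
    have h3 : 0 ≤ t * (t ^ 5 + 126 * t * m + 25 * m - m * t ^ 2) := by
      refine mul_nonneg (by linarith) ?_
      nlinarith
    have h4 : t ^ 5 - m * (t ^ 2 - 126 * t - 25) < 0 := by
      have h5 : 0 < t ^ 2 - 126 * t - 25 := by nlinarith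
      have h6 := mul_lt_mul_of_pos_right hcon h5
      have h7 : (t ^ 3 + 254 * t ^ 2) * (t ^ 2 - 126 * t - 25) =
          t ^ 5 + t ^ 2 * (128 * t * t - 32029 * t - 6350) := by ring
      have h8 : 0 ≤ 128 * t * t - 32029 * t - 6350 := by nlinarith
      have h9 := mul_nonneg (sq_nonneg t) h8
      linarith
    nlinarith
  nlinarith [sq_nonneg t]

end

end TripleSystem

/-! ### Transfer to hypergraphs and the asymptotic statement -/

theorem linearTuran_le {n : ℕ} {t : ℝ} (ht : 300 ≤ t) (hn : (n : ℝ) = 3 * t ^ 2) :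
    (linearTuran n 5 : ℝ) ≤ t ^ 3 + 100 * n := by
  classical
  obtain ⟨H, -, huni, hlin, hfree, hcard⟩ := (linearTuran_isGreatest n 5 (by norm_num)).1
  let E : Finset (Finset (Fin n)) := {e | (e : Set (Fin n)) ∈ H.edgeSet}
  have hmem : ∀ e, e ∈ E ↔ (e : Set (Fin n)) ∈ H.edgeSet := fun e => by simp [E]
  have hE : TripleSystem.PentagonFree E := by
    refine ⟨fun e he => ?_, fun {e f x y} he hf hxy hxe hye hxf hyf => ?_, ?_⟩
    · have := huni _ ((hmem e).1 he)
      rw [Set.encard_coe_eq_coe_finsetCard] at this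
      exact_mod_cast this
    · by_contra hef
      have := hlin _ ((hmem e).1 he) _ ((hmem f).1 hf) (fun h => hef (Finset.coe_injective h))
      rw [Set.encard_le_one_iff] at this
      exact hxy (this x y ⟨hxe, hxf⟩ ⟨hye, hyf⟩)
    · intro v₁ v₂ v₃ v₄ v₅ h₁ h₂ h₃ h₄ h₅ hv hh e₁ e₂ e₃ e₄ e₅ m₁ m₁' m₂ m₂' m₃ m₃' m₄ m₄' m₅ m₅'
      refine hfree ⟨![v₁, v₂, v₃, v₄, v₅], fun i => (![h₁, h₂, h₃, h₄, h₅] i : Finset (Fin n)),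
        ?_, ?_, ?_, ?_, ?_⟩
      · exact List.nodup_ofFn.1 (by simpa using hv)
      · exact Finset.coe_injective.comp (List.nodup_ofFn.1 (by simpa using hh))
      · intro i
        rw [← hmem]
        fin_cases i <;> assumption
      · intro i
        fin_cases i <;> assumption
      · intro i
        fin_cases i <;> assumption
  have hcard' : E.card = H.edgeSet.ncard := by
    rw [← Set.ncard_coe_finset, ← Set.ncard_image_of_injective _ Finset.coe_injective]
    congr 1
    ext s
    constructor
    · rintro ⟨e, he, rfl⟩
      exact (hmem e).1 he
    · intro hs
      have hs' : ((s.toFinset : Finset (Fin n)) : Set (Fin n)) = s := Set.coe_toFinset s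
      exact ⟨s.toFinset, (hmem _).2 (hs'.symm ▸ hs), hs'⟩
  have := hE.card_le ht (by rwa [Fintype.card_fin])
  rwa [hcard', hcard, Fintype.card_fin] at this

theorem le_linearTuran {n : ℕ} {t : ℝ} (ht : 0 ≤ t) (hn : (n : ℝ) = 3 * t ^ 2) :
    t ^ 3 - n ≤ (linearTuran n 5 : ℝ) := by
  have h1 := Nat.floor_le ht
  have h2 := Nat.lt_floor_add_one t
  have h3 : 3 * ⌊t⌋₊ ^ 2 ≤ n := by
    have : (3 * (⌊t⌋₊ : ℝ) ^ 2) ≤ n := by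
      rw [hn]
      gcongr
    exact_mod_cast this
  have h4 : ((⌊t⌋₊ : ℝ)) ^ 3 ≤ linearTuran n 5 := by exact_mod_cast pow_three_le_linearTuran h3
  have h5 : (0 : ℝ) ≤ ⌊t⌋₊ := Nat.cast_nonneg _
  generalize (⌊t⌋₊ : ℝ) = d at *
  -- Rounding `t` down to `d` loses `t³ - d³ ≤ 3t² = n`.
  have h6 : (t - d) * (t ^ 2 + t * d + d ^ 2) ≤ 1 * (3 * t ^ 2) := by
    refine mul_le_mul (by linarith) (by nlinarith) (by positivity) zero_le_one
  rw [hn]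
  linarith [show (t - d) * (t ^ 2 + t * d + d ^ 2) = t ^ 3 - d ^ 3 by ring]

theorem theorem1 :
    (fun n : ℕ => (linearTuran n 5 : ℝ) - (n : ℝ) ^ (3 / 2 : ℝ) / (3 * Real.sqrt 3))
      =O[Filter.atTop] (fun n : ℕ => (n : ℝ)) := by
  refine Asymptotics.IsBigO.of_bound 100 ?_
  filter_upwards [Filter.eventually_ge_atTop (3 * 300 ^ 2)] with n hn
  have hn' : (3 * 300 ^ 2 : ℝ) ≤ n := by exact_mod_cast hn
  have hsq : (n : ℝ) = 3 * √(n / 3) ^ 2 := by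
    rw [Real.sq_sqrt (by positivity)]
    ring
  have ht : 300 ≤ √((n : ℝ) / 3) := Real.le_sqrt_of_sq_le (by linarith)
  have hcube : (n : ℝ) ^ (3 / 2 : ℝ) / (3 * √3) = √(n / 3) ^ 3 := by
    have h1 : ∀ x : ℝ, 0 ≤ x → x ^ (3 / 2 : ℝ) = √x ^ 3 := by
      intro x hx
      rw [Real.sqrt_eq_rpow, ← Real.rpow_natCast, ← Real.rpow_mul hx]
      norm_num
    rw [h1 _ (Nat.cast_nonneg n), Real.sqrt_div (Nat.cast_nonneg n), div_pow, pow_succ (√3) 2,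
      Real.sq_sqrt (by norm_num)]
  rw [hcube, Real.norm_eq_abs, Real.norm_eq_abs, abs_of_nonneg (Nat.cast_nonneg n : (0 : ℝ) ≤ n),
    abs_le]
  constructor <;> linarith [linearTuran_le ht hsq, le_linearTuran (by linarith) hsq]
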